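/- Let $M,C_1>0$. There are constants $c,C,C'>0$, depending only on $M$ and $C_1$, such that the following holds for all integers $n\ge 1$, $1\le s\le p$, $1\le r\le C_1$ and all real $\lambda>0$, $\epsilon\in[0,1]$ with $$\frac{s\log\frac{ep}{s}}{n\lambda^2}\vee\frac{\epsilon^2}{\lambda^2}\le c .$$ **Model.** $\Sigma=V\Lambda V^T+I_p$, where $V\in\mathbb R^{p\times r}$ satisfies $V^TV=I_r$ and has at most $s$ nonzero rows, and $\Lambda=\mathrm{diag}(\lambda_1,\dots,\lambda_r)$ with $\lambda\le\lambda_r\le\dots\le\lambda_1\le M$. The observations $X_1,\dots,X_n$ are i.i.d. from $\mathbb P_{(\epsilon,\Sigma,Q)}=(1-\epsilon)N(0,\Sigma)+\epsilon Q$ for a probability distribution $Q$ on $\mathbb R^p$. **Estimator.** Let $\mathcal F_s$ be the set of positive semidefinite $\Gamma\in\mathbb R^{p\times p}$ for which there is $S\subset\{1,\dots,p\}$ with $|S|\le s$ such that $\Gamma_{ij}=0$ whenever $i\ne j$ and ($i\notin S$ or $j\notin S$). For each $S\subset\{1,\dots,p\}$ let $\bar{\mathcal V}_S$ be any $(1/4)$-net,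 contained in and of cardinality at most $9^{|S|}$, of the set of Euclidean unit vectors $u\in\mathbb R^p$ with $u_i=0$ for all $i\notin S$; let $\mathcal U_s=\bigcup_{|S|=\min(2s,p)}\bar{\mathcal V}_S$. Define the depth $$\mathcal D_{\mathcal U_s}(\Gamma,\{X_i\})=\min_{u\in\mathcal U_s}\min\Big\{\frac1n\sum_{i=1}^n\mathbb I\{|u^TX_i|^2\le u^T\Gamma u\},\ \frac1n\sum_{i=1}^n\mathbb I\{|u^TX_i|^2\ge u^T\Gamma u\}\Big\},$$ let $\hat\Gamma$ be any maximizer of $\Gamma\mapsto\mathcal D_{\mathcal U_s}(\Gamma,\{X_i\})$ over $\mathcal F_s$, and let $\hat V\in\mathbb R^{p\times r}$ have as columns $r$ leading orthonormal eigenvectors of $\hat\Gamma$ (the first $r$ columns of $U$ in any spectral decomposition $\hat\Gamma=UDU^T$ with $U$ orthogonal and the diagonal of $D$ nonincreasing). **Conclusion.** For all such $V$, $\Lambda$, $Q$, and all choices of the nets, of $\hat\Gamma$ and of $\hat V$, $$\|\hat V\hat V^T-VV^T\|_F^2\le C\Big(\frac{s\log\frac{ep}{s}}{n\lambda^2}\vee\frac{\epsilon^2}{\lambda^2}\Big)$$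 with $\mathbb P_{(\epsilon,\Sigma,Q)}$-probability at least $1-\exp\!\big(-C'(s\log(ep/s)+n\epsilon^2)\big)$; that is, the event that the inequality fails has outer probability at most $\exp\!\big(-C'(s\log(ep/s)+n\epsilon^2)\big)$. -/

import Mathlib

open MeasureTheory ProbabilityTheory Matrix

/-- Real Euclidean space of dimension `p`, with the Euclidean norm. -/
abbrev Vec (p : ℕ) : Type := EuclideanSpace ℝ (Fin p)

/-! ### The sparse spiked covariance model -/

open Classical in
/-- The set of (indices of) nonzero rows of a matrix. -/
noncomputable def rowSupport {p r : ℕ} (V : Matrix (Fin p) (Fin r) ℝ) : Finset (Fin p) :=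
  {i | ∃ j, V i j ≠ 0}

/-- The spiked covariance matrix `V Λ Vᵀ + I`, with `Λ = diag(l 0, …, l (r-1))`. -/
def spikedCov {p r : ℕ} (V : Matrix (Fin p) (Fin r) ℝ) (l : Fin r → ℝ) :
    Matrix (Fin p) (Fin p) ℝ :=
  V * diagonal l * Vᵀ + 1

/-- `(V, l)` parametrises a member of the sparse spiked class: `V` has orthonormal columns and at
most `s` nonzero rows, and `lam ≤ l (r-1) ≤ … ≤ l 0 ≤ M`. -/
structure IsSparseSpike {p r : ℕ} (s : ℕ) (lam M : ℝ) (V : Matrix (Fin p) (Fin r) ℝ)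
    (l : Fin r → ℝ) : Prop where
  orthonormal : Vᵀ * V = 1
  card_support_le : (rowSupport V).card ≤ s
  antitone : Antitone l
  lower : ∀ k, lam ≤ l k
  upper : ∀ k, l k ≤ M

/-- The contaminated distribution `(1 - ε) N(0, S) + ε Q`. -/
noncomputable def contaminated {p : ℕ} (ε : ℝ) (S : Matrix (Fin p) (Fin p) ℝ)
    (Q : Measure (Vec p)) : Measure (Vec p) :=
  ENNReal.ofReal (1 - ε) • multivariateGaussian (0 : Vec p) S + ENNReal.ofReal ε • Q

/-! ### Matrix depth and the deepest sparse matrix -/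

open Classical in
/-- The empirical matrix depth of `Γ` with respect to the sample `x`, relative to the set of
directions `U`. (It is used for `n ≥ 1` and for a finite nonempty `U`, where the infimum is a
minimum.) -/
noncomputable def matrixDepth {n p : ℕ} (U : Set (Vec p)) (Γ : Matrix (Fin p) (Fin p) ℝ)
    (x : Fin n → Vec p) : ℝ :=
  ⨅ u : U, min
    (({i | |inner ℝ u.1 (x i)| ^ 2 ≤ u.1.ofLp ⬝ᵥ Γ *ᵥ u.1.ofLp} : Finset (Fin n)).card / n : ℝ)
    (({i | u.1.ofLp ⬝ᵥ Γ *ᵥ u.1.ofLp ≤ |inner ℝ u.1 (x i)| ^ 2} : Finset (Fin n)).card / n : ℝ)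

/-- The sparse class `𝓕_s`: positive semidefinite matrices whose off-diagonal part vanishes
outside `S × S` for some set `S` of at most `s` coordinates. -/
def sparseClass (p s : ℕ) : Set (Matrix (Fin p) (Fin p) ℝ) :=
  {Γ | Γ.PosSemidef ∧ ∃ S : Finset (Fin p), S.card ≤ s ∧
    ∀ i j, (i ∉ S ∨ j ∉ S) → (Γ - diagonal Γ.diag) i j = 0}

/-- The unit vectors supported on the set of coordinates `S`. -/
def sparseSphere {p : ℕ} (S : Finset (Fin p)) : Set (Vec p) :=
  {u | ‖u‖ = 1 ∧ ∀ i, i ∉ S → u i = 0}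

/-- `N` is a `1/4`-net of the unit vectors supported on `S`, with at most `9 ^ |S|` points. -/
structure IsQuarterNet {p : ℕ} (S : Finset (Fin p)) (N : Finset (Vec p)) : Prop where
  subset : (N : Set (Vec p)) ⊆ sparseSphere S
  dense : ∀ u ∈ sparseSphere S, ∃ v ∈ N, ‖u - v‖ ≤ 1 / 4
  card_le : N.card ≤ 9 ^ S.card

/-- The set of directions `𝓤_s`: the union of the chosen nets over all sets of `2s` coordinates
(over the set of all `p` coordinates if `2s > p`). -/
def sparseDirections {p : ℕ} (s : ℕ) (N : Finset (Fin p) → Finset (Vec p)) : Set (Vec p) :=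
  {u | ∃ S : Finset (Fin p), S.card = min (2 * s) p ∧ u ∈ N S}

/-- `Γ` is a deepest matrix of the sparse class for the sample `x`: any maximiser is allowed. -/
def IsDeepest {n p : ℕ} (s : ℕ) (N : Finset (Fin p) → Finset (Vec p)) (x : Fin n → Vec p)
    (Γ : Matrix (Fin p) (Fin p) ℝ) : Prop :=
  Γ ∈ sparseClass p s ∧ ∀ Γ' ∈ sparseClass p s,
    matrixDepth (sparseDirections s N) Γ' x ≤ matrixDepth (sparseDirections s N) Γ x

/-! ### Leading eigenvectors and the loss -/

/-- The columns of `W` are `r` leading eigenvectors of the symmetric matrix `Γ`: they are the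
first `r` columns of `U` in some spectral decomposition `Γ = U diag(d) Uᵀ` with `U` orthogonal
and `d` nonincreasing. (If `Γ` is positive semidefinite, this is its singular value
decomposition.) -/
def IsLeadingEigenvectors {p r : ℕ} (Γ : Matrix (Fin p) (Fin p) ℝ)
    (W : Matrix (Fin p) (Fin r) ℝ) : Prop :=
  ∃ U ∈ orthogonalGroup (Fin p) ℝ, ∃ d : Fin p → ℝ, Antitone d ∧ Γ = U * diagonal d * Uᵀ ∧
    ∃ h : r ≤ p, W = U.submatrix id (Fin.castLE h)

/-- The squared Frobenius norm. -/
def frobeniusSq {p q : ℕ} (A : Matrix (Fin p) (Fin q) ℝ) : ℝ :=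
  ∑ i, ∑ j, A i j ^ 2

/-- The rate `s log(ep/s) / (n lam²) ∨ ε² / lam²`. -/
noncomputable def pcaRate (n p s : ℕ) (lam ε : ℝ) : ℝ :=
  max (s * Real.log (Real.exp 1 * p / s) / (n * lam ^ 2)) (ε ^ 2 / lam ^ 2)

/-! Let `b` be the median of the chi-square law with one degree of freedom. For every unit vector
`u`, `b uᵀΣu` is the median of `(uᵀX)²` under `N(0, Σ)`, so `bΣ` has population depth at least 1/2,
and its top `r` eigenspace is the range of `V`. Hoeffding's inequality and a union bound over at
most `exp(7 s log(ep/s))` directions put the relevant frequencies within `δ` of their probabilities,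
with `δ²` of order `s log(ep/s)/n + ε²`; contamination shifts each probability by at most `ε`. Since
`bΣ` competes in the maximisation, the estimator has depth at least `1/2 - (ε + δ)`. The chi-square
tails drop below 1/2 linearly away from `b`, so a quadratic form off by a relative error larger than
a multiple of `ε + δ` would be too shallow (`abs_quadratic_sub_le_of_depth`).

The off-diagonal part of `B = Γ̂ - bΣ` lives on at most `2s` coordinates, so bounds on the nets give
an operator norm bound (`abs_quadratic_le_of_quarterNet`, `abs_quadratic_le_of_sparse`). Ky Fan's
principle and a Davis–Kahan argument with gap `bλ` turn it into a projection error of order `r ‖B‖²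
/ (bλ)²` (`frobeniusSq_sub_le_of_perturbation`). Outside the deviation event everything is
deterministic, so the estimator need not be measurable. -/

/-! ### The chi-square median and its tails. -/

/-- On `[-R, R]` the standard normal density is smallest at the endpoints. -/
theorem mul_sub_le_gaussianReal_Ioo {R a b : ℝ} (ha : -R ≤ a) (hb : b ≤ R) (hab : a ≤ b) :
    gaussianPDFReal 0 1 R * (b - a) ≤ (gaussianReal 0 1).real (Set.Ioo a b) := by
  rw [Measure.real, gaussianReal_apply_eq_integral 0 one_ne_zero,
    ENNReal.toReal_ofReal (integral_nonneg fun x => gaussianPDFReal_nonneg 0 1 x)]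
  have h1 : ∫ _ in Set.Ioo a b, gaussianPDFReal 0 1 R = gaussianPDFReal 0 1 R * (b - a) := by
    simp [Measure.real, hab, mul_comm]
  rw [← h1]
  refine setIntegral_mono_on (by simp) (integrable_gaussianPDFReal 0 1).integrableOn
    measurableSet_Ioo fun x hx => ?_
  simp only [gaussianPDFReal]
  refine mul_le_mul_of_nonneg_left (Real.exp_le_exp.2 ?_) (by positivity)
  have h2 : |x| ≤ R := abs_le.2 ⟨by linarith [hx.1], by linarith [hx.2]⟩
  have h3 := sq_le_sq' (by linarith [abs_nonneg x, neg_abs_le R, le_abs_self R]) h2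
  rw [sq_abs] at h3
  simp only [sub_zero, NNReal.coe_one, mul_one]
  linarith

theorem exists_gaussianReal_Icc_eq_half :
    ∃ q : ℝ, 0 < q ∧ (gaussianReal 0 1).real (Set.Icc (-q) q) = 1 / 2 := by
  set f : ℝ → ℝ := fun t => ∫ x in (-t)..t, gaussianPDFReal 0 1 x with hf
  have hint := integrable_gaussianPDFReal 0 1
  have hcont : Continuous f := by
    have h := intervalIntegral.continuous_primitive (fun a b => hint.intervalIntegrable) 0
    have : f = fun t => (∫ x in (0:ℝ)..t, gaussianPDFReal 0 1 x)
        - ∫ x in (0:ℝ)..(-t), gaussianPDFReal 0 1 x := by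
      funext t
      exact (intervalIntegral.integral_interval_sub_left hint.intervalIntegrable
        hint.intervalIntegrable).symm
    rw [this]
    exact h.sub (h.comp continuous_neg)
  have hlim : Filter.Tendsto f Filter.atTop (nhds 1) := by
    rw [← integral_gaussianPDFReal_eq_one 0 one_ne_zero]
    exact intervalIntegral_tendsto_integral hint Filter.tendsto_neg_atTop_atBot Filter.tendsto_id
  have hf0 : f 0 = 0 := by simp [hf]
  obtain ⟨T, hT0, hT⟩ := ((Filter.eventually_ge_atTop (0 : ℝ)).and
    (hlim.eventually (lt_mem_nhds (show (1 / 2 : ℝ) < 1 by norm_num)))).exists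
  obtain ⟨q, hq, hfq⟩ := intermediate_value_Icc hT0 hcont.continuousOn
    (show (1 / 2 : ℝ) ∈ Set.Icc (f 0) (f T) from ⟨by rw [hf0]; norm_num, hT.le⟩)
  have hq0 : 0 < q := by
    rcases hq.1.lt_or_eq with h | h
    · exact h
    · rw [← h, hf0] at hfq; norm_num at hfq
  refine ⟨q, hq0, ?_⟩
  rw [Measure.real, gaussianReal_apply_eq_integral 0 one_ne_zero,
    ENNReal.toReal_ofReal (integral_nonneg fun x => gaussianPDFReal_nonneg 0 1 x),
    integral_Icc_eq_integral_Ioc, ← intervalIntegral.integral_of_le (by linarith)]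
  exact hfq

/-- The median `b` of the chi-square distribution with one degree of freedom, and the linear decay
of the tails of that distribution near `b`. -/
theorem exists_median_sq_gaussianReal :
    ∃ b > (0 : ℝ), ∃ κ > (0 : ℝ), ∃ h₀ > (0 : ℝ),
      1 / 2 ≤ (gaussianReal 0 1).real {g | g ^ 2 ≤ b} ∧
      1 / 2 ≤ (gaussianReal 0 1).real {g | b ≤ g ^ 2} ∧
      ∀ h, 0 < h → h ≤ h₀ →
        (gaussianReal 0 1).real {g | b + h ≤ g ^ 2} ≤ 1 / 2 - κ * h ∧
        (gaussianReal 0 1).real {g | g ^ 2 ≤ b - h} ≤ 1 / 2 - κ * h := by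
  obtain ⟨q, hq0, hq⟩ := exists_gaussianReal_Icc_eq_half
  have hset : {g : ℝ | g ^ 2 ≤ q ^ 2} = Set.Icc (-q) q := by
    ext g
    simp only [Set.mem_ofPred_eq, Set.mem_Icc]
    rw [sq_le_sq, abs_of_pos hq0, abs_le]
  -- A lower bound for the density on `[-(q+1), q+1]`, which contains every interval used below
  -- because `a ≤ 1`.
  set m := gaussianPDFReal 0 1 (q + 1) with hm
  have hm0 : 0 < m := gaussianPDFReal_pos 0 1 (q + 1) one_ne_zero
  refine ⟨q ^ 2, by positivity, m / (2 * q + 2), by positivity, min 1 q, by positivity,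
    by rw [hset, hq], ?_, fun h hh0 hh => ?_⟩
  · have h1 : (Set.Icc (-q) q)ᶜ ⊆ {g : ℝ | q ^ 2 ≤ g ^ 2} := by
      rw [← hset]
      intro g hg
      simp only [Set.mem_compl_iff, Set.mem_ofPred_eq, not_le] at hg ⊢
      exact hg.le
    have h2 := measureReal_mono (μ := gaussianReal 0 1) h1
    rw [probReal_compl_eq_one_sub measurableSet_Icc, hq] at h2
    linarith
  · have hh1 : h ≤ 1 := hh.trans (min_le_left _ _)
    have hh2 : h ≤ q := hh.trans (min_le_right _ _)
    -- Moving `g` by less than `a` from `q` moves `g²` by less than `h`, as `a (2q + a) ≤ h`. Hence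
    -- an interval of length `a` next to `q` separates the tail from the median; `a ≤ q` keeps it
    -- nonnegative.
    set a := h / (2 * q + 2) with ha
    have ha0 : 0 ≤ a := by positivity
    have hah : a * (2 * q + 2) = h := by rw [ha]; field_simp
    have haq : a ≤ q := by nlinarith
    have ha1 : a ≤ 1 := by nlinarith
    have hma : m / (2 * q + 2) * h = m * a := by rw [ha]; ring
    rw [hma]
    constructor
    · have h1 : {g : ℝ | q ^ 2 + h ≤ g ^ 2} ⊆ (Set.Icc (-q) q ∪ Set.Ioo q (q + a))ᶜ := by
        intro g hg hg'
        simp only [Set.mem_ofPred_eq] at hg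
        rcases hg' with hg' | hg'
        · rw [← hset] at hg'
          simp only [Set.mem_ofPred_eq] at hg'
          linarith
        · nlinarith [hg'.1, hg'.2]
      have h2 := measureReal_mono (μ := gaussianReal 0 1) h1
      have hdisj : Disjoint (Set.Icc (-q) q) (Set.Ioo q (q + a)) := by
        rw [Set.disjoint_left]
        intro g hg hg'
        linarith [hg.2, hg'.1]
      rw [probReal_compl_eq_one_sub (measurableSet_Icc.union measurableSet_Ioo),
        measureReal_union hdisj measurableSet_Ioo, hq] at h2
      have h3 := mul_sub_le_gaussianReal_Ioo (R := q + 1) (a := q) (b := q + a)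
        (by linarith) (by linarith) (by linarith)
      rw [← hm] at h3
      linarith
    · have h1 : {g : ℝ | g ^ 2 ≤ q ^ 2 - h} ∪ Set.Ioo (q - a) q ⊆ Set.Icc (-q) q := by
        rw [← hset]
        rintro g (hg | hg)
        · simp only [Set.mem_ofPred_eq] at hg ⊢; linarith
        · simp only [Set.mem_ofPred_eq]; nlinarith [hg.1, hg.2]
      have hdisj : Disjoint {g : ℝ | g ^ 2 ≤ q ^ 2 - h} (Set.Ioo (q - a) q) := by
        rw [Set.disjoint_left]
        intro g hg hg'
        simp only [Set.mem_ofPred_eq] at hg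
        nlinarith [hg'.1, hg'.2]
      have h2 := measureReal_mono (μ := gaussianReal 0 1) h1
      rw [measureReal_union hdisj measurableSet_Ioo, hq] at h2
      have h3 := mul_sub_le_gaussianReal_Ioo (R := q + 1) (a := q - a) (b := q)
        (by linarith) (by linarith) (by linarith)
      rw [← hm] at h3
      linarith

/-! ### One-dimensional projections and contamination. -/

theorem map_inner_multivariateGaussian {p : ℕ} {S : Matrix (Fin p) (Fin p) ℝ} (hS : S.PosSemidef)
    (w : Vec p) (hw : w.ofLp ⬝ᵥ S *ᵥ w.ofLp = 1) :
    (multivariateGaussian 0 S).map (fun x => inner ℝ w x) = gaussianReal 0 1 := by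
  have : IsProbabilityMeasure ((multivariateGaussian 0 S).map (fun x => inner ℝ w x)) :=
    Measure.isProbabilityMeasure_map (by fun_prop)
  refine Measure.ext_of_charFun ?_
  funext t
  have h := charFun_multivariateGaussian (μ := 0) hS (t • w)
  rw [charFun_apply] at h
  rw [charFun_apply, integral_map (by fun_prop) (by fun_prop), charFun_gaussianReal]
  convert h using 1
  · congr 1
    funext x
    simp [real_inner_smul_right, real_inner_comm, mul_comm]
  · simp [Matrix.mulVec_smul, hw]
    ring_nf

/-- After division by the variance all directions share one chi-square law, so the same thresholds
serve them all. -/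
theorem multivariateGaussian_real_sq_inner {p : ℕ} {S : Matrix (Fin p) (Fin p) ℝ}
    (hS : S.PosSemidef) (u : Vec p) {v : ℝ} (hv : 0 < v) (huv : u.ofLp ⬝ᵥ S *ᵥ u.ofLp = v)
    {T : Set ℝ} (hT : MeasurableSet T) :
    (multivariateGaussian 0 S).real {x | |inner ℝ u x| ^ 2 / v ∈ T}
      = (gaussianReal 0 1).real {g | g ^ 2 ∈ T} := by
  have hsq : √v ^ 2 = v := Real.sq_sqrt hv.le
  have hs0 : √v ≠ 0 := (Real.sqrt_pos.2 hv).ne'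
  rw [← map_inner_multivariateGaussian hS ((√v)⁻¹ • u), map_measureReal_apply (by fun_prop)]
  · congr 1
    ext x
    simp only [Set.mem_ofPred_eq, Set.mem_preimage, real_inner_smul_left, mul_pow, inv_pow, hsq,
      sq_abs]
    rw [div_eq_inv_mul]
  · exact (measurable_id.pow_const 2) hT
  · simp only [WithLp.ofLp_smul, Matrix.mulVec_smul, smul_dotProduct, dotProduct_smul, huv,
      smul_eq_mul]
    rw [← mul_assoc, ← mul_inv, ← sq, hsq, inv_mul_cancel₀ hv.ne']

theorem isProbabilityMeasure_contaminated {p : ℕ} {ε : ℝ} (h0 : 0 ≤ ε) (h1 : ε ≤ 1)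
    (S : Matrix (Fin p) (Fin p) ℝ) (Q : Measure (Vec p)) [IsProbabilityMeasure Q] :
    IsProbabilityMeasure (contaminated ε S Q) := by
  constructor
  simp only [contaminated, Measure.coe_add, Measure.coe_smul, Pi.add_apply, Pi.smul_apply,
    measure_univ, smul_eq_mul, mul_one]
  rw [← ENNReal.ofReal_add (by linarith) h0]
  simp

/-- The difference is `ε` times a difference of two probabilities. -/
theorem abs_contaminated_real_sub_le {p : ℕ} {ε : ℝ} (h0 : 0 ≤ ε) (h1 : ε ≤ 1)
    (S : Matrix (Fin p) (Fin p) ℝ) (Q : Measure (Vec p)) [IsProbabilityMeasure Q]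
    (A : Set (Vec p)) :
    |(contaminated ε S Q).real A - (multivariateGaussian 0 S).real A| ≤ ε := by
  have h : (contaminated ε S Q).real A
      = (1 - ε) * (multivariateGaussian 0 S).real A + ε * Q.real A := by
    simp only [contaminated]
    rw [measureReal_add_apply (by simp [ENNReal.mul_eq_top])  (by simp [ENNReal.mul_eq_top])]
    simp [measureReal_ennreal_smul_apply, h0, h1]
  have a1 := measureReal_nonneg (μ := multivariateGaussian 0 S) (s := A)
  have a2 := measureReal_nonneg (μ := Q) (s := A)
  have a3 := measureReal_le_one (μ := multivariateGaussian 0 S) (s := A)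
  have a4 := measureReal_le_one (μ := Q) (s := A)
  rw [h, abs_le]
  constructor <;> nlinarith

/-! ### Concentration of empirical frequencies. -/

open Classical in
/-- The fraction of the sample points in `A`. -/
noncomputable def empiricalFreq {E : Type*} {n : ℕ} (A : Set E) (x : Fin n → E) : ℝ :=
  ({i | x i ∈ A} : Finset (Fin n)).card / n

theorem empiricalFreq_mono {E : Type*} {n : ℕ} {A B : Set E} (h : A ⊆ B) (x : Fin n → E) :
    empiricalFreq A x ≤ empiricalFreq B x := by
  unfold empiricalFreq
  gcongr

theorem empiricalFreq_compl {E : Type*} {n : ℕ} (hn : 1 ≤ n) (A : Set E) (x : Fin n → E) :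
    empiricalFreq Aᶜ x = 1 - empiricalFreq A x := by
  classical
  have hn' : (n : ℝ) ≠ 0 := by positivity
  unfold empiricalFreq
  rw [eq_sub_iff_add_eq, ← add_div, div_eq_one_iff_eq hn']
  have := Finset.card_filter_add_card_filter_not (s := (Finset.univ : Finset (Fin n)))
    (fun i => x i ∈ A)
  simp only [Finset.card_univ, Fintype.card_fin] at this
  simp only [Set.mem_compl_iff]
  rw [add_comm]
  exact_mod_cast this

/-- Hoeffding's inequality: centred indicators are sub-Gaussian with variance proxy 1/4. -/
theorem measure_add_le_empiricalFreq {E : Type*} [MeasurableSpace E] (μ : Measure E)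
    [IsProbabilityMeasure μ] {A : Set E} (hA : MeasurableSet A) {n : ℕ} (hn : 1 ≤ n) {δ : ℝ}
    (hδ : 0 ≤ δ) :
    Measure.pi (fun _ : Fin n => μ) {x | μ.real A + δ ≤ empiricalFreq A x}
      ≤ ENNReal.ofReal (Real.exp (-(2 * n * δ ^ 2))) := by
  classical
  have hn0 : (0 : ℝ) < n := by positivity
  set f : E → ℝ := A.indicator 1 with hf
  have hfm : Measurable f := measurable_one.indicator hA
  have hint : ∫ x, f x ∂μ = μ.real A := by rw [hf, integral_indicator_one hA]
  have hsub : HasSubgaussianMGF (fun x => f x - μ.real A) ((‖(1 : ℝ) - 0‖₊ / 2) ^ 2) μ := by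
    rw [← hint]
    refine hasSubgaussianMGF_of_mem_Icc hfm.aemeasurable (Filter.Eventually.of_forall fun x => ?_)
    by_cases hx : x ∈ A <;> simp [hf, hx]
  have hsub' : ∀ i ∈ (Finset.univ : Finset (Fin n)),
      HasSubgaussianMGF (fun x : Fin n → E => f (x i) - μ.real A) ((‖(1 : ℝ) - 0‖₊ / 2) ^ 2)
        (Measure.pi fun _ : Fin n => μ) := fun i _ => by
    have he := measurePreserving_eval (fun _ : Fin n => μ) i
    refine HasSubgaussianMGF.of_map (X := fun x => f x - μ.real A)
      he.measurable.aemeasurable ?_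
    rw [he.map_eq]
    exact hsub
  have hind := iIndepFun_pi (μ := fun _ : Fin n => μ) (X := fun _ x => f x - μ.real A)
    (fun _ => (hfm.sub_const _).aemeasurable)
  have key := HasSubgaussianMGF.measure_sum_ge_le_of_iIndepFun hind hsub'
    (ε := n * δ) (by positivity)
  have hset : {x : Fin n → E | μ.real A + δ ≤ empiricalFreq A x}
      = {x | n * δ ≤ ∑ i, (f (x i) - μ.real A)} := by
    ext x
    have h1 : ∑ i, f (x i) = ({i | x i ∈ A} : Finset (Fin n)).card := by
      simp [hf, Set.indicator_apply]
    simp only [Set.mem_ofPred_eq, Finset.sum_sub_distrib, h1, Finset.sum_const, Finset.card_univ,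
      Fintype.card_fin, nsmul_eq_mul, empiricalFreq]
    rw [le_div_iff₀ hn0]
    constructor <;> intro h <;> linarith
  rw [hset]
  have hexp : -(n * δ) ^ 2 / (2 * ((∑ _i : Fin n, ((‖(1 : ℝ) - 0‖₊ / 2) ^ 2) : NNReal) : ℝ))
      = -(2 * n * δ ^ 2) := by
    simp
    field_simp
  rw [hexp] at key
  rw [← ENNReal.ofReal_toReal (measure_ne_top _ _)]
  exact ENNReal.ofReal_le_ofReal key

theorem measure_empiricalFreq_le_sub {E : Type*} [MeasurableSpace E] (μ : Measure E)
    [IsProbabilityMeasure μ] {A : Set E} (hA : MeasurableSet A) {n : ℕ} (hn : 1 ≤ n) {δ : ℝ}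
    (hδ : 0 ≤ δ) :
    Measure.pi (fun _ : Fin n => μ) {x | empiricalFreq A x ≤ μ.real A - δ}
      ≤ ENNReal.ofReal (Real.exp (-(2 * n * δ ^ 2))) := by
  refine le_trans (measure_mono fun x hx => ?_) (measure_add_le_empiricalFreq μ hA.compl hn hδ)
  simp only [Set.mem_ofPred_eq] at hx ⊢
  rw [probReal_compl_eq_one_sub hA, empiricalFreq_compl hn]
  linarith

/-! ### Counting the directions. -/

/-- Combines `p.choose k ≤ p ^ k / k!` with `k ^ k / k! ≤ exp k`, one term of the exponential
series. -/
theorem choose_le_exp_mul_div_pow {p k : ℕ} (hk : 1 ≤ k) :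
    (p.choose k : ℝ) ≤ (Real.exp 1 * p / k) ^ k := by
  have hk0 : (0 : ℝ) < k := by positivity
  have h1 : (p.choose k : ℝ) ≤ p ^ k / (k.factorial : ℝ) := Nat.choose_le_pow_div k p
  have h2 := Real.pow_div_factorial_le_exp (k : ℝ) hk0.le k
  have h3 : (0 : ℝ) < k.factorial := by positivity
  rw [div_le_iff₀ h3] at h2
  refine h1.trans ?_
  rw [div_pow, mul_pow, ← Real.exp_nat_mul, mul_one, div_le_div_iff₀ h3 (by positivity)]
  nlinarith [pow_nonneg (Nat.cast_nonneg (α := ℝ) p) k]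

theorem one_le_log_exp_mul_div {p s : ℕ} (hs : 1 ≤ s) (hsp : s ≤ p) :
    1 ≤ Real.log (Real.exp 1 * p / s) := by
  have hs0 : (0 : ℝ) < s := by positivity
  rw [Real.le_log_iff_exp_le (by have : 1 ≤ p := hs.trans hsp; positivity), le_div_iff₀ hs0]
  gcongr

open Classical in
/-- The set of directions, as a finset. -/
noncomputable def sparseDirectionsFinset {p : ℕ} (s : ℕ)
    (N : Finset (Fin p) → Finset (Vec p)) : Finset (Vec p) :=
  (Finset.univ.powersetCard (min (2 * s) p)).biUnion N

theorem mem_sparseDirectionsFinset {p s : ℕ} {N : Finset (Fin p) → Finset (Vec p)} {u : Vec p} :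
    u ∈ sparseDirectionsFinset s N ↔ u ∈ sparseDirections s N := by
  simp [sparseDirectionsFinset, sparseDirections]

/-- With `L = log(ep/s) ≥ 1`, the choice of coordinates costs `2sL` in the exponent and the nets
cost `2s log 9 ≤ 5s ≤ 5sL`. -/
theorem card_sparseDirectionsFinset_le {p s : ℕ} (hs : 1 ≤ s) (hsp : s ≤ p)
    {N : Finset (Fin p) → Finset (Vec p)} (hN : ∀ S, IsQuarterNet S (N S)) :
    ((sparseDirectionsFinset s N).card : ℝ)
      ≤ Real.exp (7 * (s * Real.log (Real.exp 1 * p / s))) := by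
  classical
  set L := Real.log (Real.exp 1 * p / s) with hL
  have hL1 : 1 ≤ L := one_le_log_exp_mul_div hs hsp
  have hp : 1 ≤ p := hs.trans hsp
  have hs0 : (1 : ℝ) ≤ s := by exact_mod_cast hs
  set k := min (2 * s) p with hk
  have hcard : (sparseDirectionsFinset s N).card ≤ p.choose k * 9 ^ k := by
    refine (Finset.card_biUnion_le_card_mul _ N (9 ^ k) fun S hS => ?_).trans (by simp [hk])
    rw [hk, ← (Finset.mem_powersetCard.1 hS).2]
    exact (hN S).card_le
  have h9 : (9 : ℝ) ≤ Real.exp (5 / 2) := by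
    have := Real.exp_one_gt_d9
    have h2 : Real.exp (5 / 2) ^ 2 = Real.exp 1 ^ 5 := by
      rw [← Real.exp_nat_mul, ← Real.exp_nat_mul]; norm_num
    have h3 : (2.7 : ℝ) ^ 5 ≤ Real.exp 1 ^ 5 := by gcongr; linarith
    nlinarith [Real.exp_pos (5 / 2)]
  have hchoose : (p.choose k : ℝ) ≤ Real.exp (2 * s * L) := by
    have hbase : Real.exp L = Real.exp 1 * p / s := Real.exp_log (by positivity)
    rcases le_total (2 * s) p with h | h
    · have hk' : k = 2 * s := min_eq_left h
      have h1 := choose_le_exp_mul_div_pow (p := p) (k := 2 * s) (by omega)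
      rw [hk']
      refine h1.trans ?_
      rw [show 2 * (s : ℝ) * L = ((2 * s : ℕ) : ℝ) * L by push_cast; ring, Real.exp_nat_mul, hbase]
      gcongr
      linarith
    · have hk' : k = p := min_eq_right h
      rw [hk', Nat.choose_self]
      simpa using by positivity
  calc ((sparseDirectionsFinset s N).card : ℝ) ≤ p.choose k * 9 ^ k := by exact_mod_cast hcard
    _ ≤ Real.exp (2 * s * L) * 9 ^ (2 * s) := by
        gcongr
        · norm_num
        · exact min_le_left _ _
    _ ≤ Real.exp (2 * s * L) * Real.exp (5 / 2) ^ (2 * s) := by gcongr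
    _ ≤ Real.exp (7 * (s * L)) := by
        rw [← Real.exp_nat_mul, ← Real.exp_add]
        gcongr
        push_cast
        nlinarith

/-! ### From nets to the operator norm. -/

/-- The vectors supported on the set of coordinates `S`. -/
def sparseSubmodule {p : ℕ} (S : Finset (Fin p)) : Submodule ℝ (Vec p) where
  carrier := {u | ∀ i, i ∉ S → u i = 0}
  add_mem' hu hv i hi := by simp [hu i hi, hv i hi]
  zero_mem' i _ := by simp
  smul_mem' a u hu i hi := by simp [hu i hi]

theorem dotProduct_mulVec_comm_of_isSymm {p : ℕ} {B : Matrix (Fin p) (Fin p) ℝ} (hB : B.IsSymm)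
    (x y : Fin p → ℝ) : x ⬝ᵥ B *ᵥ y = y ⬝ᵥ B *ᵥ x := by
  rw [dotProduct_mulVec, ← mulVec_transpose, hB.eq, dotProduct_comm]

theorem norm_sq_eq_dotProduct {p : ℕ} (u : Vec p) : ‖u‖ ^ 2 = u.ofLp ⬝ᵥ u.ofLp := by
  rw [EuclideanSpace.norm_sq_eq]
  simp [dotProduct, sq]

/-- Polarisation on unit vectors: the two quadratic terms sum to at most `4m` by the parallelogram
law. -/
theorem abs_dotProduct_mulVec_le {p : ℕ} {B : Matrix (Fin p) (Fin p) ℝ} (hB : B.IsSymm) {m : ℝ}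
    {W : Submodule ℝ (Vec p)} (hq : ∀ u ∈ W, |u.ofLp ⬝ᵥ B *ᵥ u.ofLp| ≤ m * ‖u‖ ^ 2)
    {x y : Vec p} (hx : x ∈ W) (hy : y ∈ W) :
    |x.ofLp ⬝ᵥ B *ᵥ y.ofLp| ≤ m * (‖x‖ * ‖y‖) := by
  have main : ∀ x ∈ W, ∀ y ∈ W, ‖x‖ = 1 → ‖y‖ = 1 → |x.ofLp ⬝ᵥ B *ᵥ y.ofLp| ≤ m := by
    intro x hx y hy hx1 hy1
    have h1 := hq (x + y) (W.add_mem hx hy)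
    have h2 := hq (x - y) (W.sub_mem hx hy)
    have h3 := parallelogram_law_with_norm ℝ x y
    have h4 : (x + y).ofLp ⬝ᵥ B *ᵥ (x + y).ofLp - (x - y).ofLp ⬝ᵥ B *ᵥ (x - y).ofLp
        = 4 * (x.ofLp ⬝ᵥ B *ᵥ y.ofLp) := by
      simp only [WithLp.ofLp_add, WithLp.ofLp_sub, mulVec_add, mulVec_sub, dotProduct_add,
        dotProduct_sub, add_dotProduct, sub_dotProduct]
      rw [dotProduct_mulVec_comm_of_isSymm hB y.ofLp x.ofLp]
      ring
    rw [hx1, hy1] at h3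
    have h5 : m * ‖x + y‖ ^ 2 + m * ‖x - y‖ ^ 2 = 4 * m := by linear_combination m * h3
    rw [abs_le] at h1 h2 ⊢
    constructor <;> linarith [h1.1, h1.2, h2.1, h2.2]
  by_cases hx0 : x = 0
  · simp [hx0]
  by_cases hy0 : y = 0
  · simp [hy0]
  have hxn : 0 < ‖x‖ := norm_pos_iff.2 hx0
  have hyn : 0 < ‖y‖ := norm_pos_iff.2 hy0
  have h := main (‖x‖⁻¹ • x) (W.smul_mem _ hx) (‖y‖⁻¹ • y) (W.smul_mem _ hy)
    (by rw [norm_smul, norm_inv, norm_norm, inv_mul_cancel₀ hxn.ne'])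
    (by rw [norm_smul, norm_inv, norm_norm, inv_mul_cancel₀ hyn.ne'])
  simp only [WithLp.ofLp_smul, mulVec_smul, smul_dotProduct, dotProduct_smul, smul_eq_mul] at h
  rw [← mul_assoc, ← mul_inv, abs_mul, abs_of_pos (by positivity),
    inv_mul_le_iff₀ (by positivity)] at h
  linarith

/-- Let the form attain its maximal modulus `m` on the sphere at `u₀`, and let `v` be a net point
near `u₀`. The difference of the two values is the bilinear form at `(u₀ - v, u₀ + v)`, at most `m ·
(1/4) · 2`, so `m ≤ η + m / 2`. -/
theorem abs_quadratic_le_of_quarterNet {p : ℕ} {B : Matrix (Fin p) (Fin p) ℝ} (hB : B.IsSymm)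
    {S : Finset (Fin p)} {N : Finset (Vec p)} (hN : IsQuarterNet S N) {η : ℝ}
    (hη : ∀ v ∈ N, |v.ofLp ⬝ᵥ B *ᵥ v.ofLp| ≤ η) :
    ∀ u ∈ sparseSubmodule S, |u.ofLp ⬝ᵥ B *ᵥ u.ofLp| ≤ 2 * η * ‖u‖ ^ 2 := by
  have hcont : Continuous fun u : Vec p => |u.ofLp ⬝ᵥ B *ᵥ u.ofLp| := by
    refine continuous_abs.comp (Continuous.dotProduct ?_ (Continuous.matrix_mulVec ?_ ?_)) <;>
    fun_prop
  have hscale : ∀ m : ℝ, (∀ u ∈ sparseSphere S, |u.ofLp ⬝ᵥ B *ᵥ u.ofLp| ≤ m) →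
      ∀ u ∈ sparseSubmodule S, |u.ofLp ⬝ᵥ B *ᵥ u.ofLp| ≤ m * ‖u‖ ^ 2 := by
    intro m hm u hu
    by_cases hu0 : u = 0
    · simp [hu0]
    have hun : 0 < ‖u‖ := norm_pos_iff.2 hu0
    have h := hm (‖u‖⁻¹ • u) ⟨by rw [norm_smul, norm_inv, norm_norm, inv_mul_cancel₀ hun.ne'],
      (sparseSubmodule S).smul_mem _ hu⟩
    simp only [WithLp.ofLp_smul, mulVec_smul, smul_dotProduct, dotProduct_smul, smul_eq_mul] at h
    rw [← mul_assoc, ← mul_inv, abs_mul, abs_of_pos (by positivity),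
      inv_mul_le_iff₀ (by positivity)] at h
    linarith
  refine hscale _ ?_
  have hcompact : IsCompact (sparseSphere S) := by
    have : sparseSphere S = Metric.sphere (0 : Vec p) 1 ∩ {u | ∀ i, i ∉ S → u i = 0} := by
      ext u; simp [sparseSphere]
    rw [this]
    refine (isCompact_sphere _ _).inter_right ?_
    simp only [Set.ofPred_forall]
    exact isClosed_iInter fun i => isClosed_iInter fun _ =>
      isClosed_eq (by fun_prop) continuous_const
  intro u hu
  obtain ⟨u₀, hu₀, hmax⟩ := hcompact.exists_isMaxOn ⟨u, hu⟩ hcont.continuousOn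
  set m := |u₀.ofLp ⬝ᵥ B *ᵥ u₀.ofLp| with hm
  have hm0 : 0 ≤ m := abs_nonneg _
  obtain ⟨v, hv, hd⟩ := hN.dense u₀ hu₀
  have hvS := hN.subset hv
  have hu₀W : u₀ ∈ sparseSubmodule S := hu₀.2
  have hvW : v ∈ sparseSubmodule S := hvS.2
  have hbil := abs_dotProduct_mulVec_le hB (hscale m fun u hu => hmax hu)
    ((sparseSubmodule S).sub_mem hu₀W hvW) ((sparseSubmodule S).add_mem hu₀W hvW)
  have hexp : (u₀ - v).ofLp ⬝ᵥ B *ᵥ (u₀ + v).ofLp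
      = u₀.ofLp ⬝ᵥ B *ᵥ u₀.ofLp - v.ofLp ⬝ᵥ B *ᵥ v.ofLp := by
    simp only [WithLp.ofLp_add, WithLp.ofLp_sub, mulVec_add, dotProduct_add, sub_dotProduct]
    rw [dotProduct_mulVec_comm_of_isSymm hB u₀.ofLp v.ofLp]
    ring
  have hnorm : ‖u₀ + v‖ ≤ 2 := by
    have := norm_add_le u₀ v
    rw [hu₀.1, hvS.1] at this
    linarith
  have hprod : ‖u₀ - v‖ * ‖u₀ + v‖ ≤ 1 / 4 * 2 := by gcongr
  have h1 := hη v hv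
  have h2 : m * (‖u₀ - v‖ * ‖u₀ + v‖) ≤ m * (1 / 4 * 2) := by gcongr
  have h3 := abs_sub_abs_le_abs_sub (u₀.ofLp ⬝ᵥ B *ᵥ u₀.ofLp) (v.ofLp ⬝ᵥ B *ᵥ v.ofLp)
  rw [← hexp, ← hm] at h3
  have h4 : |u.ofLp ⬝ᵥ B *ᵥ u.ofLp| ≤ m := hmax hu
  linarith

/-- If the off-diagonal part of `B` lives on `S × S`, a bound of the quadratic form on the vectors
supported on any `k` coordinates, where `k ≥ |S|` and `k ≥ 1`, extends to all vectors. -/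
theorem abs_quadratic_le_of_sparse {p k : ℕ} {B : Matrix (Fin p) (Fin p) ℝ} {S : Finset (Fin p)}
    (hBS : ∀ i j, i ≠ j → (i ∉ S ∨ j ∉ S) → B i j = 0) (hSk : S.card ≤ k) (hk1 : 1 ≤ k)
    (hkp : k ≤ p) {m : ℝ}
    (hm : ∀ T : Finset (Fin p), T.card = k →
      ∀ u ∈ sparseSubmodule T, |u.ofLp ⬝ᵥ B *ᵥ u.ofLp| ≤ m * ‖u‖ ^ 2) (u : Vec p) :
    |u.ofLp ⬝ᵥ B *ᵥ u.ofLp| ≤ m * ‖u‖ ^ 2 := by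
  classical
  have hext : ∀ T : Finset (Fin p), T.card ≤ k → ∀ w ∈ sparseSubmodule T,
      |w.ofLp ⬝ᵥ B *ᵥ w.ofLp| ≤ m * ‖w‖ ^ 2 := by
    intro T hT w hw
    obtain ⟨T', hTT', -, hT'⟩ := Finset.exists_subsuperset_card_eq (Finset.subset_univ T) hT
      (by simpa using hkp)
    exact hm T' hT' w fun i hi => hw i fun h => hi (hTT' h)
  have hdiag : ∀ j, |B j j| ≤ m := by
    intro j
    have h := hext {j} (by simpa using hk1) (EuclideanSpace.single j 1) (fun i hi => by
      simp only [Finset.mem_singleton] at hi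
      simp [hi])
    simpa using h
  set w : Vec p := WithLp.toLp 2 (fun i => if i ∈ S then u i else 0) with hw
  have hwS : w ∈ sparseSubmodule S := fun i hi => by simp [hw, hi]
  -- Outside `S` the matrix is diagonal, so the form splits into a block on `S` and a diagonal sum;
  -- the squared norm splits the same way.
  have hquad : u.ofLp ⬝ᵥ B *ᵥ u.ofLp
      = w.ofLp ⬝ᵥ B *ᵥ w.ofLp + ∑ i, (if i ∈ S then 0 else B i i * u i ^ 2) := by
    simp only [dotProduct, mulVec]
    rw [← Finset.sum_add_distrib]
    refine Finset.sum_congr rfl fun i _ => ?_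
    by_cases hi : i ∈ S
    · simp only [hw, hi, if_true, add_zero]
      congr 1
      refine Finset.sum_congr rfl fun j _ => ?_
      by_cases hj : j ∈ S
      · simp [hj]
      · rw [hBS i j (fun h => hj (h ▸ hi)) (Or.inr hj)]; simp
    · simp only [hw, hi, if_false, zero_mul, zero_add]
      rw [Finset.sum_eq_single i (fun j _ hj => by rw [hBS i j hj.symm (Or.inl hi), zero_mul])
        (by simp)]
      ring
  have hnorm : ‖u‖ ^ 2 = ‖w‖ ^ 2 + ∑ i, (if i ∈ S then 0 else u i ^ 2) := by
    simp only [EuclideanSpace.norm_sq_eq, Real.norm_eq_abs, sq_abs]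
    rw [← Finset.sum_add_distrib]
    refine Finset.sum_congr rfl fun i _ => ?_
    by_cases hi : i ∈ S <;> simp [hw, hi]
  have hsum : |∑ i, (if i ∈ S then 0 else B i i * u i ^ 2)|
      ≤ m * ∑ i, (if i ∈ S then 0 else u i ^ 2) := by
    rw [Finset.mul_sum]
    refine (Finset.abs_sum_le_sum_abs _ _).trans (Finset.sum_le_sum fun i _ => ?_)
    by_cases hi : i ∈ S
    · simp [hi]
    · simp only [hi, if_false, abs_mul, abs_sq]
      exact mul_le_mul_of_nonneg_right (hdiag i) (sq_nonneg _)
  rw [hquad, hnorm, mul_add]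
  exact (abs_add_le _ _).trans (add_le_add (hext S hSk w hwS) hsum)

/-- The bilinear bound at `(Bx, x)` reads `‖Bx‖² ≤ m ‖Bx‖ ‖x‖`. -/
theorem mulVec_dotProduct_mulVec_le {p : ℕ} {B : Matrix (Fin p) (Fin p) ℝ} (hB : B.IsSymm) {m : ℝ}
    (hq : ∀ u : Vec p, |u.ofLp ⬝ᵥ B *ᵥ u.ofLp| ≤ m * ‖u‖ ^ 2) (x : Fin p → ℝ) :
    (B *ᵥ x) ⬝ᵥ (B *ᵥ x) ≤ m ^ 2 * (x ⬝ᵥ x) := by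
  have h := abs_dotProduct_mulVec_le (W := ⊤) hB (fun u _ => hq u)
    (x := WithLp.toLp 2 (B *ᵥ x)) (y := WithLp.toLp 2 x) trivial trivial
  have h1 := norm_sq_eq_dotProduct (WithLp.toLp 2 (B *ᵥ x))
  have h2 := norm_sq_eq_dotProduct (WithLp.toLp 2 x)
  simp only at h h1 h2
  rw [← h1] at h ⊢
  rw [← h2]
  set a := ‖WithLp.toLp 2 (B *ᵥ x)‖
  set c := ‖WithLp.toLp 2 x‖
  have ha : 0 ≤ a := norm_nonneg _
  have hc : 0 ≤ c := norm_nonneg _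
  have h3 : a * a ≤ m * c * a := by nlinarith [le_abs_self (a ^ 2)]
  rcases ha.eq_or_lt with h0 | h0
  · rw [← h0, zero_pow two_ne_zero]; positivity
  · have h4 : a ≤ m * c := le_of_mul_le_mul_right h3 h0
    rw [← mul_pow]
    gcongr

/-! ### Spectral projections: Ky Fan and Davis–Kahan. -/

theorem frobeniusSq_eq_trace {p q : ℕ} (A : Matrix (Fin p) (Fin q) ℝ) :
    frobeniusSq A = (A * Aᵀ).trace := by
  simp [frobeniusSq, trace, mul_apply, sq]

theorem frobeniusSq_transpose {p q : ℕ} (A : Matrix (Fin p) (Fin q) ℝ) :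
    frobeniusSq Aᵀ = frobeniusSq A := by
  simp only [frobeniusSq, transpose_apply]
  exact Finset.sum_comm

theorem frobeniusSq_add_le {p q : ℕ} (A B : Matrix (Fin p) (Fin q) ℝ) :
    frobeniusSq (A + B) ≤ 2 * frobeniusSq A + 2 * frobeniusSq B := by
  simp only [frobeniusSq, Finset.mul_sum, ← Finset.sum_add_distrib, Matrix.add_apply]
  gcongr with i _ j _
  nlinarith [sq_nonneg (A i j - B i j)]

/-- Cauchy–Schwarz with a free weight, from the squares `(A i j - t * D i j) ^ 2`. -/
theorem trace_mul_transpose_le {p q : ℕ} (A D : Matrix (Fin p) (Fin q) ℝ) (t : ℝ) :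
    2 * t * (A * Dᵀ).trace ≤ frobeniusSq A + t ^ 2 * frobeniusSq D := by
  simp only [frobeniusSq, Finset.mul_sum, ← Finset.sum_add_distrib, trace, diag_apply, mul_apply,
    transpose_apply]
  gcongr with i _ j _
  nlinarith [sq_nonneg (A i j - t * D i j)]

theorem diag_transpose_mul_self_nonneg {p q : ℕ} (A : Matrix (Fin p) (Fin q) ℝ) (k : Fin q) :
    0 ≤ (Aᵀ * A) k k := by
  simp only [mul_apply, transpose_apply]
  exact Finset.sum_nonneg fun i _ => mul_self_nonneg _

theorem trace_mul_transpose_self {p r : ℕ} {V : Matrix (Fin p) (Fin r) ℝ} (hV : Vᵀ * V = 1) :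
    (V * Vᵀ).trace = r := by
  rw [trace_mul_comm, hV]; simp

/-- The diagonal of a compression of a projection of rank `r` by an isometry lies in `[0, 1]`. -/
theorem diag_compression_le_one {p q r : ℕ} {V : Matrix (Fin p) (Fin r) ℝ} (hV : Vᵀ * V = 1)
    {U : Matrix (Fin p) (Fin q) ℝ} (hU : Uᵀ * U = 1) (k : Fin q) :
    (Uᵀ * (V * Vᵀ) * U) k k ≤ 1 := by
  -- `1 - VVᵀ` is a symmetric idempotent, so this Gram matrix is `1 - Uᵀ(VVᵀ)U`.
  have h := diag_transpose_mul_self_nonneg ((1 - V * Vᵀ) * U) k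
  have h1 : ((1 - V * Vᵀ) * U)ᵀ * ((1 - V * Vᵀ) * U) = 1 - Uᵀ * (V * Vᵀ) * U := by
    have hP : (V * Vᵀ) * (V * Vᵀ) = V * Vᵀ := by
      rw [Matrix.mul_assoc, ← Matrix.mul_assoc Vᵀ, hV, Matrix.one_mul]
    have h2 : (1 - V * Vᵀ) * (1 - V * Vᵀ) = 1 - V * Vᵀ := by
      rw [Matrix.mul_sub, Matrix.sub_mul, Matrix.sub_mul, hP]; simp
    rw [transpose_mul, transpose_sub, transpose_mul, transpose_transpose, transpose_one,
      Matrix.mul_assoc, ← Matrix.mul_assoc (1 - V * Vᵀ), h2, Matrix.sub_mul, Matrix.mul_sub,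
      Matrix.one_mul, hU, Matrix.mul_assoc Uᵀ]
  rw [h1] at h
  simpa using h

theorem diag_compression_nonneg {p q r : ℕ} (V : Matrix (Fin p) (Fin r) ℝ)
    (U : Matrix (Fin p) (Fin q) ℝ) (k : Fin q) : 0 ≤ (Uᵀ * (V * Vᵀ) * U) k k := by
  have h := diag_transpose_mul_self_nonneg (Vᵀ * U) k
  rwa [transpose_mul, transpose_transpose, Matrix.mul_assoc, ← Matrix.mul_assoc V,
    ← Matrix.mul_assoc] at h

theorem IsLeadingEigenvectors.orthonormal {p r : ℕ} {Γ : Matrix (Fin p) (Fin p) ℝ}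
    {W : Matrix (Fin p) (Fin r) ℝ} (h : IsLeadingEigenvectors Γ W) : Wᵀ * W = 1 := by
  obtain ⟨U, hU, d, -, -, hr, rfl⟩ := h
  have hUU : Uᵀ * U = 1 := (mem_orthogonalGroup_iff' (Fin p) ℝ).1 hU
  have h := submatrix_mul_equiv Uᵀ U (Fin.castLE hr) (Equiv.refl _) (Fin.castLE hr)
  rw [hUU, submatrix_one _ (Fin.castLE_injective hr)] at h
  exact h

/-- Ky Fan's maximum principle. -/
theorem IsLeadingEigenvectors.trace_mul_le {p r : ℕ} {Γ : Matrix (Fin p) (Fin p) ℝ}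
    {W : Matrix (Fin p) (Fin r) ℝ} (h : IsLeadingEigenvectors Γ W)
    {V : Matrix (Fin p) (Fin r) ℝ} (hV : Vᵀ * V = 1) :
    (Γ * (V * Vᵀ)).trace ≤ (Γ * (W * Wᵀ)).trace := by
  have hWW := h.orthonormal
  obtain ⟨U, hU, d, hd, hΓ, hr, hW⟩ := h
  have hUU : Uᵀ * U = 1 := (mem_orthogonalGroup_iff' (Fin p) ℝ).1 hU
  have hUU' : U * Uᵀ = 1 := (mem_orthogonalGroup_iff (Fin p) ℝ).1 hU
  -- In the eigenbasis the trace is a weighted sum of eigenvalues. Any rank-`r` projection has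
  -- weights in `[0, 1]` with sum `r`; the leading one puts weight 1 on the first `r`.
  have htr : ∀ A : Matrix (Fin p) (Fin p) ℝ, (Γ * A).trace = ∑ i, d i * (Uᵀ * A * U) i i := by
    intro A
    rw [hΓ, Matrix.mul_assoc, Matrix.mul_assoc, trace_mul_comm, Matrix.mul_assoc]
    simp [trace, Matrix.diagonal_mul]
  have hsum : ∀ X : Matrix (Fin p) (Fin r) ℝ, Xᵀ * X = 1 →
      ∑ i, (Uᵀ * (X * Xᵀ) * U) i i = r := by
    intro X hX
    have : ∑ i, (Uᵀ * (X * Xᵀ) * U) i i = (Uᵀ * (X * Xᵀ) * U).trace := rfl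
    rw [this, trace_mul_comm, ← Matrix.mul_assoc, hUU', Matrix.one_mul,
      trace_mul_transpose_self hX]
  have hUW : ∀ i k, (Uᵀ * W) i k = if i = Fin.castLE hr k then 1 else 0 := by
    intro i k
    have : (Uᵀ * W) i k = (Uᵀ * U) i (Fin.castLE hr k) := by
      rw [hW]; simp [mul_apply]
    rw [this, hUU, one_apply]
  have hw : ∀ i, (Uᵀ * (W * Wᵀ) * U) i i = if (i : ℕ) < r then 1 else 0 := by
    intro i
    have h1 : Uᵀ * (W * Wᵀ) * U = (Uᵀ * W) * (Uᵀ * W)ᵀ := by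
      rw [transpose_mul, transpose_transpose]; simp only [Matrix.mul_assoc]
    rw [h1, mul_apply]
    simp only [transpose_apply, hUW]
    split_ifs with hi
    · rw [Finset.sum_eq_single ⟨i, hi⟩]
      · simp
      · intro k _ hk
        rw [if_neg (fun h => hk (by ext; simp [h])), zero_mul]
      · simp
    · refine Finset.sum_eq_zero fun k _ => ?_
      rw [if_neg (fun h => hi (by rw [h]; exact k.2)), zero_mul]
  rw [htr, htr, ← sub_nonneg, ← Finset.sum_sub_distrib]
  rcases Nat.eq_zero_or_pos r with h0 | h0
  · subst h0
    have hz : V = W := by ext i j; exact j.elim0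
    simp [hz]
  -- Both weight vectors have sum `r`, so subtracting the `r`-th eigenvalue changes nothing and
  -- makes the comparison termwise.
  set piv : ℝ := d ⟨r - 1, by omega⟩ with hpiv
  have hz : ∑ i, piv * ((Uᵀ * (W * Wᵀ) * U) i i - (Uᵀ * (V * Vᵀ) * U) i i) = 0 := by
    rw [← Finset.mul_sum, Finset.sum_sub_distrib, hsum W hWW, hsum V hV, sub_self, mul_zero]
  rw [← hz]
  refine Finset.sum_le_sum fun i _ => ?_
  have h1 := diag_compression_le_one hV hUU i
  have h0 := diag_compression_nonneg V U i
  rw [hw]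
  split_ifs with hi
  · have : piv ≤ d i := hd (Fin.le_def.2 (by simp; omega))
    nlinarith
  · have : d i ≤ piv := hd (Fin.le_def.2 (by simp; omega))
    nlinarith

/-- `BWWᵀ` and `BW` have equal Frobenius norms, and `BW` has only `r` columns: the cost is `r`, not
`p`. -/
theorem frobeniusSq_mul_projection_le {p r : ℕ} {B : Matrix (Fin p) (Fin p) ℝ} {m : ℝ}
    (hm : ∀ x : Fin p → ℝ, (B *ᵥ x) ⬝ᵥ (B *ᵥ x) ≤ m ^ 2 * (x ⬝ᵥ x))
    {W : Matrix (Fin p) (Fin r) ℝ} (hW : Wᵀ * W = 1) :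
    frobeniusSq (B * (W * Wᵀ)) ≤ r * m ^ 2 := by
  have h1 : frobeniusSq (B * (W * Wᵀ)) = frobeniusSq (B * W) := by
    rw [frobeniusSq_eq_trace, frobeniusSq_eq_trace]
    congr 1
    simp only [transpose_mul, transpose_transpose, Matrix.mul_assoc]
    rw [← Matrix.mul_assoc Wᵀ W, hW, Matrix.one_mul]
  rw [h1, ← frobeniusSq_transpose]
  have h2 : ∀ k, ∑ i, (B * W)ᵀ k i ^ 2 ≤ m ^ 2 := by
    intro k
    have h3 := hm (fun i => W i k)
    have h4 : (fun i => W i k) ⬝ᵥ (fun i => W i k) = 1 := by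
      have := congrFun (congrFun hW k) k
      rw [mul_apply, one_apply_eq] at this
      exact this
    rw [h4, mul_one] at h3
    refine le_trans (le_of_eq ?_) h3
    simp [dotProduct, mulVec, mul_apply, sq]
  calc frobeniusSq (B * W)ᵀ ≤ ∑ _k : Fin r, m ^ 2 := Finset.sum_le_sum fun k _ => h2 k
    _ = r * m ^ 2 := by simp

/-- A Davis–Kahan bound for the spiked covariance matrix. -/
theorem frobeniusSq_sub_le_of_perturbation {p r : ℕ} {V W : Matrix (Fin p) (Fin r) ℝ}
    {l : Fin r → ℝ} {Γ : Matrix (Fin p) (Fin p) ℝ} {b lam m : ℝ} (hb : 0 < b) (hlam : 0 < lam)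
    (hV : Vᵀ * V = 1) (hl : ∀ k, lam ≤ l k) (hW : IsLeadingEigenvectors Γ W)
    (hsymm : (Γ - b • spikedCov V l).IsSymm)
    (hm : ∀ x : Fin p → ℝ, ((Γ - b • spikedCov V l) *ᵥ x) ⬝ᵥ ((Γ - b • spikedCov V l) *ᵥ x)
      ≤ m ^ 2 * (x ⬝ᵥ x)) :
    frobeniusSq (W * Wᵀ - V * Vᵀ) ≤ 16 * r * m ^ 2 / (b * lam) ^ 2 := by
  have hWW := hW.orthonormal
  set B := Γ - b • spikedCov V l with hB
  set P := V * Vᵀ with hP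
  set R := W * Wᵀ with hR
  have hPs : Pᵀ = P := by rw [hP, transpose_mul, transpose_transpose]
  have hRs : Rᵀ = R := by rw [hR, transpose_mul, transpose_transpose]
  have hPP : P * P = P := by
    rw [hP, Matrix.mul_assoc, ← Matrix.mul_assoc Vᵀ, hV, Matrix.one_mul]
  have hRR : R * R = R := by
    rw [hR, Matrix.mul_assoc, ← Matrix.mul_assoc Wᵀ, hWW, Matrix.one_mul]
  have hPt : P.trace = r := trace_mul_transpose_self hV
  have hRt : R.trace = r := trace_mul_transpose_self hWW
  set F := frobeniusSq (R - P) with hF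
  have hF0 : F = 2 * r - 2 * (R * P).trace := by
    rw [hF, frobeniusSq_eq_trace, transpose_sub, hPs, hRs, Matrix.mul_sub, Matrix.sub_mul,
      Matrix.sub_mul, hPP, hRR]
    simp only [trace_sub, hPt, hRt, trace_mul_comm P R]
    ring
  -- The diagonal entries of `VᵀRV - 1` are nonpositive, so each `l k` may be lowered to `lam`;
  -- these entries sum to `-F / 2`.
  have hcurv : (V * diagonal l * Vᵀ * (R - P)).trace ≤ -(lam / 2 * F) := by
    have h1 : ∀ A : Matrix (Fin p) (Fin p) ℝ,
        (V * diagonal l * Vᵀ * A).trace = ∑ k, l k * (Vᵀ * A * V) k k := by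
      intro A
      rw [Matrix.mul_assoc, Matrix.mul_assoc, trace_mul_comm, Matrix.mul_assoc]
      simp [trace, Matrix.diagonal_mul]
    have h2 : Vᵀ * P * V = 1 := by
      rw [hP, Matrix.mul_assoc, Matrix.mul_assoc V, hV, Matrix.mul_one, hV]
    have h3 : ∑ k, (Vᵀ * R * V) k k = (R * P).trace := by
      have : ∑ k, (Vᵀ * R * V) k k = (Vᵀ * R * V).trace := rfl
      rw [this, trace_mul_comm, ← Matrix.mul_assoc, trace_mul_comm]
    have h4 : -(lam / 2 * F) = ∑ k, lam * ((Vᵀ * R * V) k k - 1) := by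
      rw [← Finset.mul_sum, Finset.sum_sub_distrib, h3, hF0]
      simp
      ring
    rw [h1, h4]
    refine Finset.sum_le_sum fun k _ => ?_
    rw [Matrix.mul_sub, Matrix.sub_mul, h2, Matrix.sub_apply, one_apply_eq]
    have := diag_compression_le_one hWW hV k
    nlinarith [hl k]
  have hopt : 0 ≤ (Γ * (R - P)).trace := by
    rw [Matrix.mul_sub, trace_sub, sub_nonneg]
    exact hW.trace_mul_le hV
  -- The identity part drops out of the trace against `R - P`, because both projections have rank
  -- `r`.
  have hΓ : Γ = b • (V * diagonal l * Vᵀ) + b • 1 + B := by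
    rw [hB, spikedCov, smul_add]; abel
  have hkey : b * (lam / 2 * F) ≤ (B * (R - P)).trace := by
    rw [hΓ, Matrix.add_mul, Matrix.add_mul, trace_add, trace_add, smul_mul_assoc, trace_smul,
      smul_mul_assoc, trace_smul, Matrix.one_mul, trace_sub, hPt, hRt] at hopt
    simp only [smul_eq_mul, sub_self, mul_zero, add_zero] at hopt
    nlinarith
  -- Both factors multiplying `B` have rank `r`, so the Frobenius norm of `B` itself, which could
  -- grow with `p`, never enters.
  have hsplit : (B * (R - P)).trace = ((B * R + P * B) * (R - P)ᵀ).trace := by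
    have h1 : R - P = R * (R - P) + (R - P) * P := by
      rw [Matrix.mul_sub, Matrix.sub_mul, hRR, hPP]; abel
    rw [transpose_sub, hRs, hPs, Matrix.add_mul, trace_add, Matrix.mul_assoc P, trace_mul_comm P,
      Matrix.mul_assoc B, Matrix.mul_assoc B, ← trace_add, ← Matrix.mul_add, ← h1]
  have hG : frobeniusSq (B * R + P * B) ≤ 4 * (r * m ^ 2) := by
    have h1 := frobeniusSq_add_le (B * R) (P * B)
    have h2 := frobeniusSq_mul_projection_le hm hWW
    have h3 : frobeniusSq (P * B) ≤ r * m ^ 2 := by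
      rw [← frobeniusSq_transpose, transpose_mul, hPs, hsymm.eq]
      exact frobeniusSq_mul_projection_le hm hV
    linarith
  -- With `t = b * lam / 2`, `hkey` gives `2t²F` on the left, so half of it absorbs the term `t²F`
  -- on the right.
  have hfin := trace_mul_transpose_le (B * R + P * B) (R - P) (b * lam / 2)
  rw [← hsplit, ← hF] at hfin
  rw [le_div_iff₀ (by positivity)]
  nlinarith [mul_le_mul_of_nonneg_left hkey (show 0 ≤ 2 * (b * lam / 2) by positivity)]

theorem measure_exists_deviation_le {E ι : Type*} [MeasurableSpace E] (μ : Measure E)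
    [IsProbabilityMeasure μ] (T : Finset ι) {A : ι → Set E} (hA : ∀ i, MeasurableSet (A i)) {n : ℕ}
    (hn : 1 ≤ n) {δ : ℝ} (hδ : 0 ≤ δ) :
    Measure.pi (fun _ : Fin n => μ) {x | ∃ i ∈ T, δ ≤ |empiricalFreq (A i) x - μ.real (A i)|}
      ≤ ENNReal.ofReal (T.card * (2 * Real.exp (-(2 * n * δ ^ 2)))) := by
  have hsub : {x : Fin n → E | ∃ i ∈ T, δ ≤ |empiricalFreq (A i) x - μ.real (A i)|}
      ⊆ ⋃ i ∈ T, ({x | μ.real (A i) + δ ≤ empiricalFreq (A i) x}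
        ∪ {x | empiricalFreq (A i) x ≤ μ.real (A i) - δ}) := by
    rintro x ⟨i, hi, h⟩
    refine Set.mem_biUnion hi ?_
    rcases le_abs.1 h with h | h
    · left; simp only [Set.mem_ofPred_eq]; linarith
    · right; simp only [Set.mem_ofPred_eq]; linarith
  refine (measure_mono hsub).trans ((measure_biUnion_finset_le _ _).trans ?_)
  rw [ENNReal.ofReal_mul (by positivity), ENNReal.ofReal_natCast, ← nsmul_eq_mul]
  refine Finset.sum_le_card_nsmul _ _ _ fun i _ => (measure_union_le _ _).trans ?_
  rw [two_mul, ENNReal.ofReal_add (by positivity) (by positivity)]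
  exact add_le_add (measure_add_le_empiricalFreq μ (hA i) hn hδ)
    (measure_empiricalFreq_le_sub μ (hA i) hn hδ)

/-! ### The spiked covariance matrix -/

theorem dotProduct_spikedCov_mulVec {p r : ℕ} (V : Matrix (Fin p) (Fin r) ℝ) (l : Fin r → ℝ)
    (u : Fin p → ℝ) :
    u ⬝ᵥ spikedCov V l *ᵥ u = ∑ k, l k * (Vᵀ *ᵥ u) k ^ 2 + u ⬝ᵥ u := by
  rw [spikedCov, add_mulVec, one_mulVec, dotProduct_add, Matrix.mul_assoc, ← mulVec_mulVec,
    ← mulVec_mulVec, dotProduct_mulVec, ← mulVec_transpose]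
  congr 1
  simp only [dotProduct, mulVec_diagonal]
  exact Finset.sum_congr rfl fun k _ => by ring

theorem isSymm_spikedCov {p r : ℕ} (V : Matrix (Fin p) (Fin r) ℝ) (l : Fin r → ℝ) :
    (spikedCov V l).IsSymm := by
  simp [spikedCov, Matrix.IsSymm, Matrix.mul_assoc]

namespace IsSparseSpike

variable {p r s : ℕ} {lam M : ℝ} {V : Matrix (Fin p) (Fin r) ℝ} {l : Fin r → ℝ}

theorem posSemidef (h : IsSparseSpike s lam M V l) (hlam : 0 ≤ lam) :
    (spikedCov V l).PosSemidef := by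
  refine Matrix.PosSemidef.of_dotProduct_mulVec_nonneg ?_ fun u => ?_
  · exact (Matrix.conjTranspose_eq_transpose_of_trivial _).trans (isSymm_spikedCov V l)
  · rw [star_trivial, dotProduct_spikedCov_mulVec]
    refine add_nonneg (Finset.sum_nonneg fun k _ =>
      mul_nonneg (hlam.trans (h.lower k)) (sq_nonneg _)) ?_
    exact Finset.sum_nonneg fun i _ => mul_self_nonneg _

theorem one_le_quadratic (h : IsSparseSpike s lam M V l) (hlam : 0 ≤ lam) {u : Vec p}
    (hu : ‖u‖ = 1) : 1 ≤ u.ofLp ⬝ᵥ spikedCov V l *ᵥ u.ofLp := by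
  rw [dotProduct_spikedCov_mulVec, ← norm_sq_eq_dotProduct, hu, one_pow]
  have : 0 ≤ ∑ k, l k * (Vᵀ *ᵥ u.ofLp) k ^ 2 := Finset.sum_nonneg fun k _ =>
    mul_nonneg (hlam.trans (h.lower k)) (sq_nonneg _)
  linarith

theorem quadratic_le (h : IsSparseSpike s lam M V l) (hM : 0 ≤ M) {u : Vec p}
    (hu : ‖u‖ = 1) : u.ofLp ⬝ᵥ spikedCov V l *ᵥ u.ofLp ≤ M + 1 := by
  rw [dotProduct_spikedCov_mulVec, ← norm_sq_eq_dotProduct, hu, one_pow]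
  have h1 : ∑ k, (Vᵀ *ᵥ u.ofLp) k ^ 2 ≤ 1 := by
    -- A unit vector is an isometry with one column, so the compression bound yields `‖Vᵀu‖² ≤ 1`.
    have hU : (Matrix.replicateCol (Fin 1) u.ofLp)ᵀ * Matrix.replicateCol (Fin 1) u.ofLp = 1 := by
      ext i j
      have := norm_sq_eq_dotProduct u
      rw [hu, one_pow] at this
      rw [Subsingleton.elim i j, one_apply_eq, mul_apply]
      exact this.symm
    have h2 := diag_compression_le_one h.orthonormal hU 0
    refine le_trans (le_of_eq ?_) h2
    have h3 : (Matrix.replicateCol (Fin 1) u.ofLp)ᵀ * (V * Vᵀ) * Matrix.replicateCol (Fin 1) u.ofLp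
        = (Vᵀ * Matrix.replicateCol (Fin 1) u.ofLp)ᵀ * (Vᵀ * Matrix.replicateCol (Fin 1) u.ofLp) := by
      rw [transpose_mul, transpose_transpose]
      simp only [Matrix.mul_assoc]
    rw [h3]
    simp [mul_apply, mulVec, dotProduct, sq, mul_comm]
  have h4 : ∑ k, l k * (Vᵀ *ᵥ u.ofLp) k ^ 2 ≤ ∑ k, M * (Vᵀ *ᵥ u.ofLp) k ^ 2 :=
    Finset.sum_le_sum fun k _ => mul_le_mul_of_nonneg_right (h.upper k) (sq_nonneg _)
  rw [← Finset.mul_sum] at h4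
  nlinarith

theorem spikedCov_apply_eq_zero (V : Matrix (Fin p) (Fin r) ℝ) (l : Fin r → ℝ) {i j : Fin p}
    (hij : i ≠ j) (h : i ∉ rowSupport V ∨ j ∉ rowSupport V) : spikedCov V l i j = 0 := by
  have hz : ∀ i, i ∉ rowSupport V → ∀ k, V i k = 0 := by
    intro i hi k
    by_contra hne
    exact hi (by simp only [rowSupport, Finset.mem_filter, Finset.mem_univ, true_and]; exact ⟨k, hne⟩)
  rw [spikedCov, Matrix.add_apply, one_apply_ne hij, add_zero, mul_apply]
  refine Finset.sum_eq_zero fun k _ => ?_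
  rw [mul_diagonal, transpose_apply]
  rcases h with h | h
  · rw [hz i h, zero_mul, zero_mul]
  · rw [hz j h, mul_zero]

/-- Makes `bΣ` an admissible competitor of the deepest matrix. -/
theorem smul_mem_sparseClass (h : IsSparseSpike s lam M V l) (hlam : 0 ≤ lam) {b : ℝ}
    (hb : 0 ≤ b) : b • spikedCov V l ∈ sparseClass p s := by
  refine ⟨(h.posSemidef hlam).smul hb, rowSupport V, h.card_support_le, fun i j hij => ?_⟩
  by_cases hne : i = j
  · simp [hne]
  · simp [hne, spikedCov_apply_eq_zero V l hne hij]

end IsSparseSpike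

theorem apply_eq_zero_of_mem_sparseClass {p : ℕ} {Γ : Matrix (Fin p) (Fin p) ℝ} {S : Finset (Fin p)}
    (h : ∀ i j, (i ∉ S ∨ j ∉ S) → (Γ - diagonal Γ.diag) i j = 0) {i j : Fin p} (hij : i ≠ j)
    (hS : i ∉ S ∨ j ∉ S) : Γ i j = 0 := by
  have := h i j hS
  rwa [Matrix.sub_apply, diagonal_apply_ne _ hij, sub_zero] at this

/-! ### The depth -/

theorem matrixDepth_eq {n p : ℕ} (U : Set (Vec p)) (Γ : Matrix (Fin p) (Fin p) ℝ)
    (x : Fin n → Vec p) :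
    matrixDepth U Γ x = ⨅ u : U, min
      (empiricalFreq {y | |inner ℝ u.1 y| ^ 2 ≤ u.1.ofLp ⬝ᵥ Γ *ᵥ u.1.ofLp} x)
      (empiricalFreq {y | u.1.ofLp ⬝ᵥ Γ *ᵥ u.1.ofLp ≤ |inner ℝ u.1 y| ^ 2} x) := by
  unfold matrixDepth empiricalFreq
  congr 1

theorem matrixDepth_le {n p : ℕ} {U : Set (Vec p)} (Γ : Matrix (Fin p) (Fin p) ℝ)
    (x : Fin n → Vec p) {u : Vec p} (hu : u ∈ U) :
    matrixDepth U Γ x ≤ min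
      (empiricalFreq {y | |inner ℝ u y| ^ 2 ≤ u.ofLp ⬝ᵥ Γ *ᵥ u.ofLp} x)
      (empiricalFreq {y | u.ofLp ⬝ᵥ Γ *ᵥ u.ofLp ≤ |inner ℝ u y| ^ 2} x) := by
  rw [matrixDepth_eq]
  refine ciInf_le (f := fun u : U => min
      (empiricalFreq {y | |inner ℝ u.1 y| ^ 2 ≤ u.1.ofLp ⬝ᵥ Γ *ᵥ u.1.ofLp} x)
      (empiricalFreq {y | u.1.ofLp ⬝ᵥ Γ *ᵥ u.1.ofLp ≤ |inner ℝ u.1 y| ^ 2} x)) ⟨0, ?_⟩ ⟨u, hu⟩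
  rintro _ ⟨w, rfl⟩
  exact le_min (by unfold empiricalFreq; positivity) (by unfold empiricalFreq; positivity)

/-- Over an empty index the real infimum would take the default value 0, and the lower bound on the
depth of `bΣ` would fail. -/
theorem sparseDirections_nonempty {p s : ℕ} (hs : 1 ≤ s) (hsp : s ≤ p)
    {N : Finset (Fin p) → Finset (Vec p)} (hN : ∀ S, IsQuarterNet S (N S)) :
    (sparseDirections s N).Nonempty := by
  have hp : 0 < p := by omega
  obtain ⟨S, hS, -, hcard⟩ := Finset.exists_subsuperset_card_eq
    (Finset.subset_univ ({⟨0, hp⟩} : Finset (Fin p)))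
    (show _ ≤ min (2 * s) p by simp; omega) (by simp)
  obtain ⟨v, hv, -⟩ := (hN S).dense (EuclideanSpace.single ⟨0, hp⟩ 1) ⟨by simp, fun i hi => by
    have : i ≠ ⟨0, hp⟩ := fun h => hi (hS (by simp [h]))
    simp [this]⟩
  exact ⟨v, S, hcard, hv⟩

theorem norm_eq_one_of_mem_sparseDirections {p s : ℕ} {N : Finset (Fin p) → Finset (Vec p)}
    (hN : ∀ S, IsQuarterNet S (N S)) {u : Vec p} (hu : u ∈ sparseDirections s N) : ‖u‖ = 1 := by
  obtain ⟨S, -, hu⟩ := hu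
  exact ((hN S).subset hu).1

/-- A matrix at least as deep as `b • Σ` is close to `b • Σ` in the directions `U`, if the empirical
frequencies are close to the Gaussian probabilities at the thresholds `b` and `b ± h`. -/
theorem abs_quadratic_sub_le_of_depth {n p : ℕ} {U : Set (Vec p)} (hU : U.Nonempty)
    {S Γ : Matrix (Fin p) (Fin p) ℝ} (hS : ∀ u ∈ U, 0 < u.ofLp ⬝ᵥ S *ᵥ u.ofLp)
    {b h τ β : ℝ} {x : Fin n → Vec p}
    (hdeep : matrixDepth U (b • S) x ≤ matrixDepth U Γ x)
    (hτ : ∀ u ∈ U, 1 / 2 - τ ≤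
      empiricalFreq {y | |inner ℝ u y| ^ 2 / (u.ofLp ⬝ᵥ S *ᵥ u.ofLp) ∈ Set.Iic b} x)
    (hτ' : ∀ u ∈ U, 1 / 2 - τ ≤
      empiricalFreq {y | |inner ℝ u y| ^ 2 / (u.ofLp ⬝ᵥ S *ᵥ u.ofLp) ∈ Set.Ici b} x)
    (hβ : ∀ u ∈ U,
      empiricalFreq {y | |inner ℝ u y| ^ 2 / (u.ofLp ⬝ᵥ S *ᵥ u.ofLp) ∈ Set.Ici (b + h)} x < β)
    (hβ' : ∀ u ∈ U,
      empiricalFreq {y | |inner ℝ u y| ^ 2 / (u.ofLp ⬝ᵥ S *ᵥ u.ofLp) ∈ Set.Iic (b - h)} x < β)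
    (hβτ : β ≤ 1 / 2 - τ) {u : Vec p} (hu : u ∈ U) :
    |u.ofLp ⬝ᵥ (Γ - b • S) *ᵥ u.ofLp| ≤ h * (u.ofLp ⬝ᵥ S *ᵥ u.ofLp) := by
  have : Nonempty U := hU.to_subtype
  have hlow : 1 / 2 - τ ≤ matrixDepth U (b • S) x := by
    rw [matrixDepth_eq]
    refine le_ciInf fun w => le_min ((hτ w.1 w.2).trans ?_) ((hτ' w.1 w.2).trans ?_)
    · refine empiricalFreq_mono (fun y hy => ?_) x
      simp only [Set.mem_ofPred_eq, Set.mem_Iic] at hy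
      rw [div_le_iff₀ (hS w.1 w.2)] at hy
      simpa [smul_mulVec] using hy
    · refine empiricalFreq_mono (fun y hy => ?_) x
      simp only [Set.mem_ofPred_eq, Set.mem_Ici] at hy
      rw [le_div_iff₀ (hS w.1 w.2)] at hy
      simpa [smul_mulVec] using hy
  obtain ⟨h1, h2⟩ := le_min_iff.1 ((hlow.trans hdeep).trans (matrixDepth_le Γ x hu))
  have hv := hS u hu
  rw [sub_mulVec, dotProduct_sub, smul_mulVec, dotProduct_smul, smul_eq_mul, abs_le]
  set v := u.ofLp ⬝ᵥ S *ᵥ u.ofLp with hvdef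
  constructor
  -- If the form of `Γ` were below `(b - h) v`, its lower frequency would be at most that of the
  -- tail below `b - h`, less than `β` and hence than the depth.
  · by_contra hcon
    have h3 : empiricalFreq {y | |inner ℝ u y| ^ 2 ≤ u.ofLp ⬝ᵥ Γ *ᵥ u.ofLp} x
        ≤ empiricalFreq {y | |inner ℝ u y| ^ 2 / v ∈ Set.Iic (b - h)} x := by
      refine empiricalFreq_mono (fun y hy => ?_) x
      simp only [Set.mem_ofPred_eq, Set.mem_Iic] at hy ⊢
      rw [div_le_iff₀ hv]
      linarith
    linarith [hβ' u hu]
  · by_contra hcon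
    have h3 : empiricalFreq {y | u.ofLp ⬝ᵥ Γ *ᵥ u.ofLp ≤ |inner ℝ u y| ^ 2} x
        ≤ empiricalFreq {y | |inner ℝ u y| ^ 2 / v ∈ Set.Ici (b + h)} x := by
      refine empiricalFreq_mono (fun y hy => ?_) x
      simp only [Set.mem_ofPred_eq, Set.mem_Ici] at hy ⊢
      rw [le_div_iff₀ hv]
      linarith
    linarith [hβ u hu]

/-- From the sparse directions to the spectral projections. -/
theorem frobeniusSq_sub_le_of_sparseDirections {p s r : ℕ} {lam M b η : ℝ} (hs : 1 ≤ s)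
    (hsp : s ≤ p) (hlam : 0 < lam) (hb : 0 < b) {N : Finset (Fin p) → Finset (Vec p)}
    (hN : ∀ S, IsQuarterNet S (N S)) {V W : Matrix (Fin p) (Fin r) ℝ} {l : Fin r → ℝ}
    (hV : IsSparseSpike s lam M V l) {Γ : Matrix (Fin p) (Fin p) ℝ} (hΓ : Γ ∈ sparseClass p s)
    (hW : IsLeadingEigenvectors Γ W)
    (hη : ∀ u ∈ sparseDirections s N, |u.ofLp ⬝ᵥ (Γ - b • spikedCov V l) *ᵥ u.ofLp| ≤ η) :
    frobeniusSq (W * Wᵀ - V * Vᵀ) ≤ 16 * r * (2 * η) ^ 2 / (b * lam) ^ 2 := by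
  classical
  obtain ⟨hpsd, S, hScard, hS⟩ := hΓ
  have hsymm : (Γ - b • spikedCov V l).IsSymm := by
    have h1 : Γ.IsSymm := (Matrix.conjTranspose_eq_transpose_of_trivial _).symm.trans hpsd.1
    exact h1.sub ((isSymm_spikedCov V l).smul b)
  -- The supports of `Γ` and of `V` together have at most `2s` coordinates, which is why the
  -- directions use `min (2 * s) p`.
  have hall := abs_quadratic_le_of_sparse (B := Γ - b • spikedCov V l) (S := S ∪ rowSupport V)
    (k := min (2 * s) p) (m := 2 * η) (fun i j hij h => ?_) ?_ (by omega) (min_le_right _ _)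
    (fun T hT => abs_quadratic_le_of_quarterNet hsymm (hN T) fun v hv => hη v ⟨T, hT, hv⟩)
  · exact frobeniusSq_sub_le_of_perturbation hb hlam hV.orthonormal hV.lower hW hsymm
      (mulVec_dotProduct_mulVec_le hsymm hall)
  · simp only [Finset.mem_union, not_or] at h
    rw [Matrix.sub_apply, Matrix.smul_apply,
      apply_eq_zero_of_mem_sparseClass hS hij (h.imp And.left And.left),
      IsSparseSpike.spikedCov_apply_eq_zero V l hij (h.imp And.right And.right), smul_zero,
      sub_zero]
  · refine le_min ((Finset.card_union_le _ _).trans ?_) ?_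
    · have := hV.card_support_le
      omega
    · simpa using Finset.card_le_univ (S ∪ rowSupport V)

/-- With high probability, a deepest sparse matrix is close to `b • Σ` in all sparse directions,
where `b` is the median of the chi-square distribution with one degree of freedom. -/
theorem measure_quadratic_deviation_le {b κ h δ ε : ℝ}
    (hb1 : 1 / 2 ≤ (gaussianReal 0 1).real {g | g ^ 2 ≤ b})
    (hb2 : 1 / 2 ≤ (gaussianReal 0 1).real {g | b ≤ g ^ 2})
    (hb3 : (gaussianReal 0 1).real {g | b + h ≤ g ^ 2} ≤ 1 / 2 - κ * h)
    (hb4 : (gaussianReal 0 1).real {g | g ^ 2 ≤ b - h} ≤ 1 / 2 - κ * h)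
    (hδ : 0 ≤ δ) (hε0 : 0 ≤ ε) (hε1 : ε ≤ 1) (hκh : 2 * (ε + δ) ≤ κ * h)
    {n p s : ℕ} (hn : 1 ≤ n) (hs : 1 ≤ s) (hsp : s ≤ p)
    {N : Finset (Fin p) → Finset (Vec p)} (hN : ∀ S, IsQuarterNet S (N S))
    {S : Matrix (Fin p) (Fin p) ℝ} (hS : S.PosSemidef)
    (hSpos : ∀ u ∈ sparseDirections s N, 0 < u.ofLp ⬝ᵥ S *ᵥ u.ofLp)
    (hSmem : b • S ∈ sparseClass p s)
    {Γhat : (Fin n → Vec p) → Matrix (Fin p) (Fin p) ℝ} (hΓ : ∀ x, IsDeepest s N x (Γhat x))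
    (Q : Measure (Vec p)) [IsProbabilityMeasure Q] :
    Measure.pi (fun _ : Fin n => contaminated ε S Q)
        {x | ∃ u ∈ sparseDirections s N,
          h * (u.ofLp ⬝ᵥ S *ᵥ u.ofLp) < |u.ofLp ⬝ᵥ (Γhat x - b • S) *ᵥ u.ofLp|}
      ≤ ENNReal.ofReal (((sparseDirectionsFinset s N).card * 4)
          * (2 * Real.exp (-(2 * n * δ ^ 2)))) := by
  have := isProbabilityMeasure_contaminated hε0 hε1 S Q
  set T : Fin 4 → Set ℝ := ![Set.Iic b, Set.Ici b, Set.Ici (b + h), Set.Iic (b - h)] with hT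
  have hTm : ∀ a, MeasurableSet (T a) := by
    intro a
    fin_cases a
    exacts [measurableSet_Iic, measurableSet_Ici, measurableSet_Ici, measurableSet_Iic]
  set A : Vec p × Fin 4 → Set (Vec p) := fun i =>
    {y | |inner ℝ i.1 y| ^ 2 / (i.1.ofLp ⬝ᵥ S *ᵥ i.1.ofLp) ∈ T i.2} with hA
  have hAm : ∀ i, MeasurableSet (A i) := fun i => by
    have hmeas : Measurable fun y : Vec p =>
        |inner ℝ i.1 y| ^ 2 / (i.1.ofLp ⬝ᵥ S *ᵥ i.1.ofLp) := by
      have : Continuous fun y : Vec p => |inner ℝ i.1 y| ^ 2 / (i.1.ofLp ⬝ᵥ S *ᵥ i.1.ofLp) :=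
        ((continuous_abs.comp (by fun_prop)).pow 2).div_const _
      exact this.measurable
    exact hmeas (hTm i.2)
  have hdev := measure_exists_deviation_le (contaminated ε S Q)
    (sparseDirectionsFinset s N ×ˢ (Finset.univ : Finset (Fin 4))) hAm hn hδ
  rw [Finset.card_product, Finset.card_univ, Fintype.card_fin] at hdev
  push_cast at hdev
  refine le_trans (measure_mono fun x hx => ?_) hdev
  by_contra hgood
  simp only [Set.mem_ofPred_eq, not_exists, not_and, not_le] at hgood
  obtain ⟨u, hu, hlt⟩ := hx
  -- Sampling costs `δ` and contamination costs `ε`.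
  have hfreq : ∀ w ∈ sparseDirections s N, ∀ a : Fin 4,
      |empiricalFreq (A (w, a)) x - (gaussianReal 0 1).real {g | g ^ 2 ∈ T a}| < ε + δ := by
    intro w hw a
    have h1 := hgood (w, a) (Finset.mem_product.2
      ⟨mem_sparseDirectionsFinset.2 hw, Finset.mem_univ _⟩)
    have h2 := abs_contaminated_real_sub_le hε0 hε1 S Q (A (w, a))
    rw [← multivariateGaussian_real_sq_inner hS w (hSpos w hw) rfl (hTm a)]
    refine (abs_sub_le _ ((contaminated ε S Q).real (A (w, a))) _).trans_lt ?_
    simp only [hA] at h1 h2 ⊢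
    linarith
  -- The requirement `β ≤ 1 / 2 - τ` is exactly `2 * (ε + δ) ≤ κ * h`.
  refine hlt.not_ge (abs_quadratic_sub_le_of_depth (τ := ε + δ) (β := 1 / 2 - κ * h + (ε + δ))
    (sparseDirections_nonempty hs hsp hN) hSpos ((hΓ x).2 _ hSmem) (fun w hw => ?_)
    (fun w hw => ?_) (fun w hw => ?_) (fun w hw => ?_) (by linarith) hu)
  · have := (abs_lt.1 (hfreq w hw 0)).1
    change _ < empiricalFreq {y | |inner ℝ w y| ^ 2 / (w.ofLp ⬝ᵥ S *ᵥ w.ofLp) ∈ Set.Iic b} x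
      - (gaussianReal 0 1).real {g | g ^ 2 ≤ b} at this
    linarith
  · have := (abs_lt.1 (hfreq w hw 1)).1
    change _ < empiricalFreq {y | |inner ℝ w y| ^ 2 / (w.ofLp ⬝ᵥ S *ᵥ w.ofLp) ∈ Set.Ici b} x
      - (gaussianReal 0 1).real {g | b ≤ g ^ 2} at this
    linarith
  · have := (abs_lt.1 (hfreq w hw 2)).2
    change empiricalFreq {y | |inner ℝ w y| ^ 2 / (w.ofLp ⬝ᵥ S *ᵥ w.ofLp) ∈ Set.Ici (b + h)} x
      - (gaussianReal 0 1).real {g | b + h ≤ g ^ 2} < _ at this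
    linarith
  · have := (abs_lt.1 (hfreq w hw 3)).2
    change empiricalFreq {y | |inner ℝ w y| ^ 2 / (w.ofLp ⬝ᵥ S *ᵥ w.ofLp) ∈ Set.Iic (b - h)} x
      - (gaussianReal 0 1).real {g | g ^ 2 ≤ b - h} < _ at this
    linarith

theorem theorem3p8 (M C₁ : ℝ) (hM : 0 < M) (hC₁ : 0 < C₁) :
    ∃ c > (0 : ℝ), ∃ C > (0 : ℝ), ∃ C' > (0 : ℝ),
      ∀ (n p s r : ℕ) (lam ε : ℝ),
        1 ≤ n → 1 ≤ s → s ≤ p → 1 ≤ r → (r : ℝ) ≤ C₁ → 0 < lam → 0 ≤ ε → ε ≤ 1 →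
        pcaRate n p s lam ε ≤ c →
        -- any choice of the nets
        ∀ N : Finset (Fin p) → Finset (Vec p), (∀ S, IsQuarterNet S (N S)) →
        -- any version of the estimator
        ∀ (Γhat : (Fin n → Vec p) → Matrix (Fin p) (Fin p) ℝ)
          (Vhat : (Fin n → Vec p) → Matrix (Fin p) (Fin r) ℝ),
          (∀ x, IsDeepest s N x (Γhat x)) →
          (∀ x, IsLeadingEigenvectors (Γhat x) (Vhat x)) →
        -- any member of the sparse spiked class and any contamination
        ∀ (V : Matrix (Fin p) (Fin r) ℝ) (l : Fin r → ℝ), IsSparseSpike s lam M V l →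
        ∀ Q : Measure (Vec p), IsProbabilityMeasure Q →
          -- the (outer) probability that the bound fails, for `n` i.i.d. observations
          Measure.pi (fun _ : Fin n => contaminated ε (spikedCov V l) Q)
              {x | ¬ frobeniusSq (Vhat x * (Vhat x)ᵀ - V * Vᵀ) ≤ C * pcaRate n p s lam ε}
            ≤ ENNReal.ofReal
                (Real.exp (-(C' * (s * Real.log (Real.exp 1 * p / s) + n * ε ^ 2)))) := by
  obtain ⟨b, hb, κ, hκ, h₀, hh₀, hb1, hb2, htail⟩ := exists_median_sq_gaussianReal
  -- The first constant forces `h ≤ h₀`, using `lam ≤ M`. In the second, `14976 = 64 * 234`: 16 from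
  -- Davis–Kahan, 4 from the net factor 2 squared, 234 from `hsq`.
  refine ⟨κ ^ 2 * h₀ ^ 2 / (234 * M ^ 2), by positivity,
    14976 * C₁ * (M + 1) ^ 2 / (b ^ 2 * κ ^ 2), by positivity, 1, one_pos, ?_⟩
  intro n p s r lam ε hn hs hsp hr hrC hlam hε0 hε1 hrate N hN Γhat Vhat hΓ hVhat V l hV Q hQ
  have hn0 : (0 : ℝ) < n := by positivity
  have hs1 : (1 : ℝ) ≤ s := by exact_mod_cast hs
  have hL1 := one_le_log_exp_mul_div hs hsp
  set L := Real.log (Real.exp 1 * p / s) with hL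
  set R := pcaRate n p s lam ε with hR
  have hlamM : lam ≤ M := (hV.lower ⟨0, hr⟩).trans (hV.upper _)
  have hsL1 : 1 ≤ s * L := by nlinarith
  have hR1 : s * L / n ≤ lam ^ 2 * R := by
    have h1 : s * L / (n * lam ^ 2) ≤ R := le_max_left _ _
    rw [div_le_iff₀ (by positivity)] at h1
    rw [div_le_iff₀ hn0]
    linarith
  have hR2 : ε ^ 2 ≤ lam ^ 2 * R := by
    have h1 : ε ^ 2 / lam ^ 2 ≤ R := le_max_right _ _
    rw [div_le_iff₀ (by positivity)] at h1
    linarith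
  have hsLn : 0 < s * L / n := by positivity
  have hlamR : 0 < lam ^ 2 * R := hsLn.trans_le hR1
  have hR0 : 0 < R := pos_of_mul_pos_right hlamR (by positivity)
  -- The factor 6 makes the Hoeffding exponent `12 (sL + nε²)`, which beats the `7sL` of the
  -- directions and the `3sL` that absorbs the factor 8.
  set δ := √(6 * (s * L / n + ε ^ 2)) with hδ
  have hδsq : δ ^ 2 = 6 * (s * L / n + ε ^ 2) := Real.sq_sqrt (by positivity)
  have hδ0 : 0 < δ := Real.sqrt_pos.2 (by positivity)
  set h := 3 * (ε + δ) / κ with hh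
  have hκh : κ * h = 3 * (ε + δ) := by rw [hh]; field_simp
  have hpos : 0 < h := by positivity
  -- `δ² ≤ 12 lam² R`, so `9 (ε + δ)² ≤ 18 (ε² + δ²) ≤ 18 · 13 lam² R`.
  have hsq : (κ * h) ^ 2 ≤ 234 * (lam ^ 2 * R) := by
    rw [hκh]
    nlinarith [sq_nonneg (ε - δ)]
  have hle : h ≤ h₀ := by
    have h1 : lam ^ 2 * R ≤ M ^ 2 * (κ ^ 2 * h₀ ^ 2 / (234 * M ^ 2)) := by gcongr
    have h2 : M ^ 2 * (κ ^ 2 * h₀ ^ 2 / (234 * M ^ 2)) = (κ * h₀) ^ 2 / 234 := by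
      field_simp
    have h3 : (κ * h) ^ 2 ≤ (κ * h₀) ^ 2 := by linarith
    have h4 := abs_le_of_sq_le_sq h3 (by positivity)
    exact le_of_mul_le_mul_left ((le_abs_self _).trans h4) hκ
  obtain ⟨hb3, hb4⟩ := htail h hpos hle
  have hnorm := fun u (hu : u ∈ sparseDirections s N) => norm_eq_one_of_mem_sparseDirections hN hu
  have hdev := measure_quadratic_deviation_le hb1 hb2 hb3 hb4 hδ0.le hε0 hε1 (by linarith)
    hn hs hsp hN (hV.posSemidef hlam.le)
    (fun u hu => one_pos.trans_le (hV.one_le_quadratic hlam.le (hnorm u hu)))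
    (hV.smul_mem_sparseClass hlam.le hb.le) hΓ Q
  refine (measure_mono fun x hx => ?_).trans (hdev.trans (ENNReal.ofReal_le_ofReal ?_))
  · by_contra hgood
    simp only [Set.mem_ofPred_eq, not_exists, not_and, not_lt] at hgood
    refine hx ((frobeniusSq_sub_le_of_sparseDirections (η := h * (M + 1)) hs hsp hlam hb hN hV
      (hΓ x).1 (hVhat x) fun u hu => (hgood u hu).trans ?_).trans ?_)
    · exact mul_le_mul_of_nonneg_left (hV.quadratic_le hM.le (hnorm u hu)) hpos.le
    · have h1 : 16 * (r : ℝ) * (2 * (h * (M + 1))) ^ 2 / (b * lam) ^ 2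
          = 64 * (M + 1) ^ 2 / (b ^ 2 * κ ^ 2 * lam ^ 2) * (r * (κ * h) ^ 2) := by
        field_simp
        ring
      have h2 : 14976 * C₁ * (M + 1) ^ 2 / (b ^ 2 * κ ^ 2) * R
          = 64 * (M + 1) ^ 2 / (b ^ 2 * κ ^ 2 * lam ^ 2) * (C₁ * (234 * (lam ^ 2 * R))) := by
        field_simp
        ring
      rw [h1, h2]
      gcongr
  · have hcard := card_sparseDirectionsFinset_le hs hsp hN
    rw [← hL] at hcard
    have h8 : (8 : ℝ) ≤ Real.exp (3 * (s * L)) := by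
      have h1 := Real.exp_one_gt_d9
      have h2 : Real.exp 3 = Real.exp 1 ^ 3 := by rw [← Real.exp_nat_mul]; norm_num
      have h3 : (2 : ℝ) ^ 3 ≤ Real.exp 1 ^ 3 := by gcongr; linarith
      have h4 : Real.exp 3 ≤ Real.exp (3 * (s * L)) := Real.exp_le_exp.2 (by linarith)
      linarith
    have hexp : 2 * n * δ ^ 2 = 12 * (s * L) + 12 * (n * ε ^ 2) := by
      rw [hδsq]
      field_simp
      ring
    calc ((sparseDirectionsFinset s N).card : ℝ) * 4 * (2 * Real.exp (-(2 * n * δ ^ 2)))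
        = (sparseDirectionsFinset s N).card * 8 * Real.exp (-(2 * n * δ ^ 2)) := by ring
      _ ≤ Real.exp (7 * (s * L)) * Real.exp (3 * (s * L)) * Real.exp (-(2 * n * δ ^ 2)) := by
          gcongr
      _ = Real.exp (-(2 * (s * L) + 12 * (n * ε ^ 2))) := by
          rw [← Real.exp_add, ← Real.exp_add, hexp]
          ring_nf
      _ ≤ Real.exp (-(1 * (s * L + n * ε ^ 2))) := by
          refine Real.exp_le_exp.2 ?_
          have : 0 ≤ n * ε ^ 2 := by positivity
          linarith
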